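/- Let $K\ge 2$ be the number of arms, $\tau\in\mathbb R$ a threshold and $R>0$. A problem instance $(M,\mu)$ consists of a mean vector $\mu\in\mathbb R^K$ and a preference matrix $M\in[0,1]^{K\times K}$ with $M_{ij}+M_{ji}=1$ for all $i,j$. Write $S_\tau=\{i:\mu_i\ge\tau\}$ and $p_i=\frac1{K-1}\sum_{j\ne i}M_{ij}$; an instance is required to satisfy $p_i>p_j$ for all $i\in S_\tau$, $j\notin S_\tau$. In each round an algorithm, possibly randomized and using only its past decisions and observations (and not the unknown $(M,\mu)$), either pulls an arm $i$ and observes an independent draw from $\mathcal N(\mu_i,R^2)$, or duels two arms $i,j$ and observes an independent Bernoulli($M_{ij}$) outcome, or stops and outputs a set of arms. It recovers $S_\tau$ on an instance with probability at least $1-\delta$ if, under the law of the interaction with that instance, with probability at least $1-\delta$ it stops and its output equals $S_\tau$. Let $0<\delta\le 0.15$, and let $\mathcal A$ be an algorithm that recovers $S_\tau$ with probability at least $1-\delta$ on every instance in which no $\mu_i$ equals $\tau$. Let $(M,\mu)$ be an instance on which $\mathcal A$ recovers $S_\tau$ with probability at least $1-\delta$ (in particular, any instance in which no $\mu_i$ equals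 $\tau$), with $M_{ij}\ge\frac38$ for all $i,j\in[K]$, and let $k\in S_\tau$. Let $\Delta_k=|\mu_k-\tau|$ and $\Delta^c_k=p_k-\min_{i\in S_\tau}p_i$, and let $T^{\mathrm{duel}}_k$ and $T^{\mathrm{pull}}_k$ be the numbers of duels in which arm $k$ takes part and of pulls of arm $k$ made by $\mathcal A$ before it stops. Then $$\mathbb E_{M,\mu}\!\left[(\Delta^c_k)^2\,T^{\mathrm{duel}}_k+(\Delta_k)^2\,T^{\mathrm{pull}}_k\right]\ \ge\ c\,\log\frac1{2\delta},\qquad c=\min\left\{\tfrac1{10},\tfrac{R^2}{2}\right\},$$ where the expectation may be $+\infty$, and $0\cdot\infty=0$. -/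

import Mathlib

open MeasureTheory ProbabilityTheory
open scoped ENNReal NNReal

noncomputable section

namespace DuelBandit

/-- The score (Borda score) of arm `i` for a preference matrix `M`: the probability that `i` beats
a uniformly chosen other arm. -/
def score {K : ℕ} (M : Fin K → Fin K → ℝ) (i : Fin K) : ℝ :=
  (1 / ((K : ℝ) - 1)) * ∑ j ∈ Finset.univ.erase i, M i j

/-- A problem instance with `K` arms and threshold `τ`: mean rewards `μ` and a preference matrix
`M`, where every arm with mean at least `τ` has a larger score than every arm with mean
below `τ`. -/
structure Problem (K : ℕ) (τ : ℝ) where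
  μ : Fin K → ℝ
  M : Fin K → Fin K → ℝ
  M_nonneg : ∀ i j, 0 ≤ M i j
  M_add_swap : ∀ i j, M i j + M j i = 1
  score_lt : ∀ i j, τ ≤ μ i → μ j < τ → score M j < score M i

namespace Problem

variable {K : ℕ} {τ : ℝ}

/-- The positive arms. -/
def posSet (I : Problem K τ) : Finset (Fin K) := Finset.univ.filter fun i => τ ≤ I.μ i

/-- The gap between the mean of arm `i` and the threshold. -/
def pullGap (I : Problem K τ) (i : Fin K) : ℝ := |I.μ i - τ|

/-- The duel gap: the distance from the score of `i` to the lowest score of a positive arm if `i`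
is positive, and to the highest score of a negative arm if `i` is negative. -/
def duelGap (I : Problem K τ) (i : Fin K) : ℝ :=
  if τ ≤ I.μ i then score I.M i - ⨅ j : {j : Fin K // τ ≤ I.μ j}, score I.M j
  else (⨆ j : {j : Fin K // I.μ j < τ}, score I.M j) - score I.M i

end Problem

/-- What an algorithm does in one round: pull an arm, duel two arms, or stop and output a set of
arms as its estimate of the positive set. -/
inductive Decision (K : ℕ) where
  | pull (i : Fin K)
  | duel (i j : Fin K)
  | halt (S : Finset (Fin K))

instance (K : ℕ) : MeasurableSpace (Decision K) := ⊤

/-- The decision taken in a round, with the value observed. -/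
abbrev Round (K : ℕ) : Type := Decision K × ℝ

/-- A (possibly randomized) algorithm: the law of its first decision, and the conditional law of
its next decision given the rounds `0, …, n`. Decisions after the first `halt` are ignored. -/
structure Algorithm (K : ℕ) where
  first : Measure (Decision K)
  isProbabilityMeasure_first : IsProbabilityMeasure first
  next : (n : ℕ) → Kernel (Finset.Iic n → Round K) (Decision K)
  isMarkovKernel_next : ∀ n, IsMarkovKernel (next n)

/-- The law of the observation: `N(μ i, R²)` for a pull of `i`; for a duel of `i` and `j`, the
value `1` with probability `M i j` and `0` otherwise; a dummy value `0` for `halt`. -/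
def obsLaw {K : ℕ} {τ : ℝ} (I : Problem K τ) (R : ℝ≥0) : Decision K → Measure ℝ
  | .pull i => gaussianReal (I.μ i) (R ^ 2)
  | .duel i j => ENNReal.ofReal (I.M i j) • Measure.dirac 1
      + ENNReal.ofReal (1 - I.M i j) • Measure.dirac 0
  | .halt _ => Measure.dirac 0

/-- `obsLaw` as a kernel. -/
def obs {K : ℕ} {τ : ℝ} (I : Problem K τ) (R : ℝ≥0) : Kernel (Decision K) ℝ where
  toFun := obsLaw I R
  measurable' := measurable_from_top

instance {K : ℕ} {τ : ℝ} (I : Problem K τ) (R : ℝ≥0) : IsMarkovKernel (obs I R) := by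
  refine ⟨fun d => ?_⟩
  change IsProbabilityMeasure (obsLaw I R d)
  cases d with
  | pull i => unfold obsLaw; infer_instance
  | duel i j =>
    refine ⟨?_⟩
    have h0 := I.M_nonneg i j
    have h1 := I.M_nonneg j i
    have h2 := I.M_add_swap i j
    simp only [obsLaw, Measure.add_apply, Measure.smul_apply, measure_univ, smul_eq_mul, mul_one]
    rw [← ENNReal.ofReal_add h0 (by linarith)]
    simp
  | halt S => unfold obsLaw; infer_instance

/-- A round is not a `halt`. -/
def Decision.Active {K : ℕ} : Decision K → Prop
  | .halt _ => False
  | _ => True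

/-- The decision is a duel in which arm `k` takes part. -/
def Decision.IsDuelOf {K : ℕ} (k : Fin K) : Decision K → Prop
  | .duel i j => i = k ∨ j = k
  | _ => False

/-- The decision is a pull of arm `k`. -/
def Decision.IsPullOf {K : ℕ} (k : Fin K) : Decision K → Prop
  | .pull i => i = k
  | _ => False

/-- The algorithm has not stopped before round `t`. -/
def RunningAt {K : ℕ} (ω : ℕ → Round K) (t : ℕ) : Prop := ∀ s < t, (ω s).1.Active

open Classical in
/-- The number of duels in which arm `k` takes part, up to stopping. -/
def numDuels {K : ℕ} (k : Fin K) (ω : ℕ → Round K) : ℝ≥0∞ :=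
  ∑' t, if RunningAt ω t ∧ (ω t).1.IsDuelOf k then 1 else 0

open Classical in
/-- The number of pulls of arm `k`, up to stopping. -/
def numPulls {K : ℕ} (k : Fin K) (ω : ℕ → Round K) : ℝ≥0∞ :=
  ∑' t, if RunningAt ω t ∧ (ω t).1.IsPullOf k then 1 else 0

/-- The algorithm stops, and outputs `S`. -/
def Outputs {K : ℕ} (S : Finset (Fin K)) (ω : ℕ → Round K) : Prop :=
  ∃ t, RunningAt ω t ∧ (ω t).1 = .halt S

namespace Algorithm

variable {K : ℕ} {τ : ℝ}

instance (A : Algorithm K) : IsProbabilityMeasure A.first := A.isProbabilityMeasure_first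

instance (A : Algorithm K) (n : ℕ) : IsMarkovKernel (A.next n) := A.isMarkovKernel_next n

/-- The law of round `n + 1` given the rounds `0, …, n`: the decision is drawn from the algorithm,
and the observation, given everything else, from the law of that decision. -/
def step (A : Algorithm K) (I : Problem K τ) (R : ℝ≥0) (n : ℕ) :
    Kernel (Finset.Iic n → Round K) (Round K) :=
  A.next n ⊗ₖ Kernel.prodMkLeft _ (obs I R)

instance (A : Algorithm K) (I : Problem K τ) (R : ℝ≥0) (n : ℕ) :
    IsMarkovKernel (A.step I R n) := by
  unfold step; infer_instance

/-- The law of the sequence of rounds of algorithm `A` on the instance `I`, with Gaussian rewards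
of standard deviation `R`. -/
def law (A : Algorithm K) (I : Problem K τ) (R : ℝ≥0) : Measure (ℕ → Round K) :=
  Kernel.trajMeasure (X := fun _ => Round K) (A.first ⊗ₘ obs I R) (A.step I R)

/-- On the instance `I`, the algorithm stops and outputs exactly the positive set, with
probability at least `1 - δ`. -/
def Recovers (A : Algorithm K) (I : Problem K τ) (R : ℝ≥0) (δ : ℝ) : Prop :=
  ENNReal.ofReal (1 - δ) ≤ A.law I R {ω | Outputs I.posSet ω}

end Algorithm

end DuelBandit

end

/-!
Fix a positive arm `k` and compare `I` with an instance on which `k` lies just below the threshold: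
its mean becomes `τ - ε` and its winning probabilities drop by `duelGap k + ε`, which is just enough
to take its score below that of every other positive arm. The correct outputs on the two instances
differ, so the event of outputting `I.posSet` has probability at least `1 - δ` under one law and at
most `δ` under the other, and the Kullback-Leibler divergence of the two laws is at least
`(1 - 2δ) log ((1 - δ) / δ) ≥ log (1 / (2δ))`.

By the chain rule that divergence is at most the expected sum of the divergences of the
observations: `10 (duelGap k + ε)²` for a duel of `k`, `(pullGap k + ε)² / (2R²)` for a pull of `k`,
and at most `ε² / (2R²)` for anything else. Since the law of the interaction also covers the
meaningless rounds after stopping, the comparison is made for the algorithm that repeats its halting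
decision forever, whose later rounds carry no information.
The limit `ε → 0` is taken for the first `n` rounds, where the counts are finite, and only then
`n → ∞`; in the other order a vanishing gap would meet an infinite expected count.
-/

noncomputable section

namespace DuelBandit

section Divergence

open InformationTheory

variable {α β : Type*} {mα : MeasurableSpace α} {mβ : MeasurableSpace β}

lemma mul_le_klFun_add_exp_sub_one {r : ℝ} (hr : 0 ≤ r) (x : ℝ) :
    r * x ≤ klFun r + (Real.exp x - 1) := by
  rw [klFun_apply]
  obtain rfl | hr := hr.eq_or_lt
  · simpa using (Real.exp_pos x).le
  · have tangent := mul_le_mul_of_nonneg_left (Real.add_one_le_exp (x - Real.log r)) hr.le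
    rw [Real.exp_sub, Real.exp_log hr, mul_div_cancel₀ _ hr.ne'] at tangent
    linarith

lemma klFun_le_sub_one_sq {x : ℝ} (hx : 0 ≤ x) : klFun x ≤ (x - 1) ^ 2 := by
  rw [klFun_apply]
  obtain rfl | hx := hx.eq_or_lt
  · simp
  · nlinarith [mul_le_mul_of_nonneg_left (Real.log_le_sub_one_of_pos hx) hx.le]

lemma ofReal_integral_sub_integral_exp_le_klDiv (μ ν : Measure α) [IsFiniteMeasure μ]
    [IsFiniteMeasure ν] {f : α → ℝ} (hf : Integrable f μ)
    (hexp : Integrable (fun x => Real.exp (f x)) ν) :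
    ENNReal.ofReal (∫ x, f x ∂μ - ∫ x, (Real.exp (f x) - 1) ∂ν) ≤ klDiv μ ν := by
  by_cases hfin : klDiv μ ν = ∞
  · simp [hfin]
  obtain ⟨hac, hllr⟩ := klDiv_ne_top_iff.1 hfin
  have hkl : Integrable (fun x => klFun (μ.rnDeriv ν x).toReal) ν :=
    (integrable_klFun_rnDeriv_iff hac).2 hllr
  have hexp' : Integrable (fun x => Real.exp (f x) - 1) ν := hexp.sub (integrable_const 1)
  refine ENNReal.ofReal_le_of_le_toReal ?_
  rw [toReal_klDiv_eq_integral_klFun hac, ← integral_rnDeriv_smul hac, sub_le_iff_le_add,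
    ← integral_add hkl hexp']
  exact integral_mono ((integrable_rnDeriv_smul_iff hac).2 hf) (hkl.add hexp') fun x =>
    mul_le_klFun_add_exp_sub_one ENNReal.toReal_nonneg (f x)

lemma mul_div_add_one_sub_mul_div_le_one {q δ : ℝ} (hδ0 : 0 < δ) (hδ : δ ≤ 1 / 2) (hq : q ≤ δ) :
    q * ((1 - δ) / δ) + (1 - q) * (δ / (1 - δ)) ≤ 1 := by
  have hδ1 : 0 < 1 - δ := by linarith
  calc q * ((1 - δ) / δ) + (1 - q) * (δ / (1 - δ))
      = 1 - (δ - q) * ((1 - 2 * δ) / (δ * (1 - δ))) := by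
        field_simp
        ring
    _ ≤ 1 := sub_le_self _
        (mul_nonneg (by linarith) (div_nonneg (by linarith) (by positivity)))

lemma ofReal_mul_log_div_le_klDiv (μ ν : Measure α) [IsProbabilityMeasure μ]
    [IsProbabilityMeasure ν] {E : Set α} (hE : MeasurableSet E) {δ : ℝ} (hδ0 : 0 < δ)
    (hδ : δ ≤ 1 / 2) (hνE : ν.real E ≤ δ) :
    ENNReal.ofReal ((2 * μ.real E - 1) * Real.log ((1 - δ) / δ)) ≤ klDiv μ ν := by
  classical
  set L := Real.log ((1 - δ) / δ)
  have hexpL : Real.exp L = (1 - δ) / δ := Real.exp_log (div_pos (by linarith) hδ0)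
  have hexpL' : Real.exp (-L) = δ / (1 - δ) := by rw [Real.exp_neg, hexpL, inv_div]
  have integral_two_valued (ρ : Measure α) [IsProbabilityMeasure ρ] (a b : ℝ) :
      ∫ x, E.piecewise (fun _ => a) (fun _ => b) x ∂ρ = ρ.real E * a + (1 - ρ.real E) * b := by
    rw [integral_piecewise hE (integrable_const a).integrableOn (integrable_const b).integrableOn]
    simp [hE, probReal_compl_eq_one_sub]
  have integrable_two_valued (ρ : Measure α) [IsProbabilityMeasure ρ] (a b : ℝ) :
      Integrable (E.piecewise (fun _ => a) (fun _ => b)) ρ :=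
    Integrable.piecewise hE (integrable_const a).integrableOn (integrable_const b).integrableOn
  have exp_test : (fun x => Real.exp (E.piecewise (fun _ => L) (fun _ => -L) x))
      = E.piecewise (fun _ => (1 - δ) / δ) (fun _ => δ / (1 - δ)) := by
    ext x
    rw [Set.apply_piecewise _ _ _ (fun _ => Real.exp)]
    simp only [hexpL, hexpL']
  refine le_trans (ENNReal.ofReal_le_ofReal ?_) (ofReal_integral_sub_integral_exp_le_klDiv μ ν
    (integrable_two_valued μ L (-L)) (exp_test ▸ integrable_two_valued ν _ _))
  rw [integral_sub (exp_test ▸ integrable_two_valued ν _ _) (integrable_const 1), exp_test,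
    integral_two_valued, integral_two_valued, integral_const, probReal_univ, one_smul]
  linarith [mul_div_add_one_sub_mul_div_le_one hδ0 hδ hνE]

lemma klDiv_withDensity_eq_lintegral (ν : Measure α) [IsFiniteMeasure ν] {f : α → ℝ≥0∞}
    (hf : Measurable f) [IsFiniteMeasure (ν.withDensity f)] :
    klDiv (ν.withDensity f) ν = ∫⁻ x, ENNReal.ofReal (klFun (f x).toReal) ∂ν := by
  rw [klDiv_eq_lintegral_klFun_of_ac (withDensity_absolutelyContinuous ν f)]
  refine lintegral_congr_ae ?_
  filter_upwards [Measure.rnDeriv_withDensity ν hf] with x hx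
  rw [hx]

lemma klDiv_withDensity_le_lintegral_sub_one_sq (ν : Measure α) [IsFiniteMeasure ν] {f : α → ℝ≥0∞}
    (hf : Measurable f) [IsFiniteMeasure (ν.withDensity f)] :
    klDiv (ν.withDensity f) ν ≤ ∫⁻ x, ENNReal.ofReal (((f x).toReal - 1) ^ 2) ∂ν := by
  rw [klDiv_withDensity_eq_lintegral ν hf]
  exact lintegral_mono fun x =>
    ENNReal.ofReal_le_ofReal (klFun_le_sub_one_sq ENNReal.toReal_nonneg)

lemma klDiv_eq_ofReal_integral_of_eq_withDensity_exp {μ ν : Measure α} [IsProbabilityMeasure μ]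
    [IsProbabilityMeasure ν] {l : α → ℝ} (hl : Measurable l) (hint : Integrable l μ)
    (hμ : μ = ν.withDensity fun x => ENNReal.ofReal (Real.exp (l x))) :
    klDiv μ ν = ENNReal.ofReal (∫ x, l x ∂μ) := by
  have hac : μ ≪ ν := hμ ▸ withDensity_absolutelyContinuous _ _
  have hdens : μ.rnDeriv ν =ᵐ[ν] fun x => ENNReal.ofReal (Real.exp (l x)) :=
    hμ ▸ Measure.rnDeriv_withDensity ν (by fun_prop)
  have hllr : llr μ ν =ᵐ[μ] l := by
    filter_upwards [hac.ae_le hdens] with x hx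
    rw [llr, hx, ENNReal.toReal_ofReal (Real.exp_pos _).le, Real.log_exp]
  rw [klDiv_of_ac_of_integrable hac (hint.congr hllr.symm), integral_congr_ae hllr]
  simp

lemma gaussianReal_eq_withDensity_exp (m m' : ℝ) {v : ℝ≥0} (hv : v ≠ 0) :
    gaussianReal m v = (gaussianReal m' v).withDensity fun x =>
      ENNReal.ofReal (Real.exp ((m - m') / v * x - (m ^ 2 - m' ^ 2) / (2 * v))) := by
  rw [gaussianReal_of_var_ne_zero _ hv, gaussianReal_of_var_ne_zero _ hv,
    ← withDensity_mul _ (by fun_prop) (by fun_prop)]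
  congr with x
  simp only [Pi.mul_apply, gaussianPDF]
  rw [← ENNReal.ofReal_mul (gaussianPDFReal_nonneg _ _ _), gaussianPDFReal, gaussianPDFReal,
    mul_assoc (_⁻¹), ← Real.exp_add]
  congr 3
  field_simp
  ring

lemma klDiv_gaussianReal_same_variance (m m' : ℝ) {v : ℝ≥0} (hv : v ≠ 0) :
    klDiv (gaussianReal m v) (gaussianReal m' v) = ENNReal.ofReal ((m - m') ^ 2 / (2 * v)) := by
  have hlin : Integrable (fun x => (m - m') / v * x) (gaussianReal m v) :=
    ((memLp_id_gaussianReal 1).integrable le_rfl).const_mul _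
  have haff : Integrable (fun x => (m - m') / v * x - (m ^ 2 - m' ^ 2) / (2 * v))
      (gaussianReal m v) := hlin.sub (integrable_const _)
  rw [klDiv_eq_ofReal_integral_of_eq_withDensity_exp (by fun_prop) haff
    (gaussianReal_eq_withDensity_exp m m' hv), integral_sub hlin (integrable_const _),
    integral_const_mul, integral_id_gaussianReal, integral_const, probReal_univ, one_smul]
  congr 1
  field_simp
  ring

lemma compProd_eq_withDensity_rnDeriv [MeasurableSpace.CountableOrCountablyGenerated α β]
    (μ : Measure α) [IsFiniteMeasure μ] {κ η : Kernel α β} [IsFiniteKernel κ] [IsFiniteKernel η]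
    (hac : ∀ᵐ x ∂μ, κ x ≪ η x) :
    μ ⊗ₘ κ = (μ ⊗ₘ η).withDensity fun p => κ.rnDeriv η p.1 p.2 := by
  rw [← Measure.compProd_withDensity (Kernel.measurable_rnDeriv κ η)]
  refine Measure.compProd_congr ?_
  filter_upwards [hac] with x hx
  exact (Kernel.withDensity_rnDeriv_eq hx).symm

lemma klDiv_compProd_right_eq_lintegral [MeasurableSpace.CountableOrCountablyGenerated α β]
    (μ : Measure α) [IsFiniteMeasure μ] (κ η : Kernel α β) [IsFiniteKernel κ] [IsFiniteKernel η] :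
    klDiv (μ ⊗ₘ κ) (μ ⊗ₘ η) = ∫⁻ x, klDiv (κ x) (η x) ∂μ := by
  by_cases hac : ∀ᵐ x ∂μ, κ x ≪ η x
  · have hdens := compProd_eq_withDensity_rnDeriv μ hac
    have : IsFiniteMeasure ((μ ⊗ₘ η).withDensity fun p => κ.rnDeriv η p.1 p.2) :=
      hdens ▸ inferInstance
    rw [hdens, klDiv_withDensity_eq_lintegral _ (Kernel.measurable_rnDeriv κ η),
      Measure.lintegral_compProd (by fun_prop)]
    refine lintegral_congr_ae ?_
    filter_upwards [hac] with x hx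
    rw [klDiv_eq_lintegral_klFun_of_ac hx]
    refine lintegral_congr_ae ?_
    filter_upwards [Kernel.rnDeriv_eq_rnDeriv_measure (κ := κ) (η := η) (a := x)] with y hy
    rw [hy]
  · have hset : MeasurableSet {x | κ x ≪ η x}ᶜ :=
      (Kernel.measurableSet_absolutelyContinuous κ η).compl
    rw [klDiv_of_not_ac (mt Measure.absolutelyContinuous_compProd_right_iff.1 hac), eq_comm,
      eq_top_iff]
    calc ∞ = ∫⁻ _ in {x | κ x ≪ η x}ᶜ, ∞ ∂μ := by
          rw [setLIntegral_const, ENNReal.top_mul (by rwa [ae_iff] at hac)]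
      _ = ∫⁻ x in {x | κ x ≪ η x}ᶜ, klDiv (κ x) (η x) ∂μ :=
          setLIntegral_congr_fun hset fun x hx => (klDiv_of_not_ac hx).symm
      _ ≤ ∫⁻ x, klDiv (κ x) (η x) ∂μ := setLIntegral_le_lintegral _ _

lemma two_point_eq_withDensity [DecidableEq α] [MeasurableSingletonClass α] {a b : α}
    (hab : a ≠ b) (p : ℝ) {q : ℝ} (hq0 : 0 < q) (hq1 : q < 1) :
    ENNReal.ofReal p • Measure.dirac a + ENNReal.ofReal (1 - p) • Measure.dirac b
      = (ENNReal.ofReal q • Measure.dirac a + ENNReal.ofReal (1 - q) • Measure.dirac b).withDensity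
          fun x => ENNReal.ofReal (if x = a then p / q else (1 - p) / (1 - q)) := by
  have hq1' : 0 < 1 - q := by linarith
  rw [withDensity_add_measure, withDensity_smul_measure, withDensity_smul_measure,
    dirac_withDensity, dirac_withDensity, if_pos rfl, if_neg hab.symm, smul_smul, smul_smul,
    ← ENNReal.ofReal_mul hq0.le, ← ENNReal.ofReal_mul hq1'.le, mul_div_cancel₀ _ hq0.ne',
    mul_div_cancel₀ _ hq1'.ne']

lemma klDiv_two_point_le [MeasurableSingletonClass α] {a b : α} (hab : a ≠ b) {p q : ℝ}
    (hp0 : 0 ≤ p) (hp1 : p ≤ 1) (hq0 : 0 < q) (hq1 : q < 1) :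
    klDiv (ENNReal.ofReal p • Measure.dirac a + ENNReal.ofReal (1 - p) • Measure.dirac b)
        (ENNReal.ofReal q • Measure.dirac a + ENNReal.ofReal (1 - q) • Measure.dirac b)
      ≤ ENNReal.ofReal ((p - q) ^ 2 / (q * (1 - q))) := by
  classical
  have : 0 ≤ 1 - p := by linarith
  have hq1' : 0 < 1 - q := by linarith
  have isFiniteMeasure_two_point (r : ℝ) : IsFiniteMeasure
      (ENNReal.ofReal r • Measure.dirac a + ENNReal.ofReal (1 - r) • Measure.dirac b) :=
    ⟨by simp⟩
  have hdens := two_point_eq_withDensity hab p hq0 hq1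
  have hfin := isFiniteMeasure_two_point p
  have hmeas : Measurable fun x => ENNReal.ofReal (if x = a then p / q else (1 - p) / (1 - q)) :=
    (Measurable.ite (measurableSet_singleton a) measurable_const measurable_const).ennreal_ofReal
  rw [hdens] at hfin ⊢
  refine le_trans (klDiv_withDensity_le_lintegral_sub_one_sq _ hmeas) (le_of_eq ?_)
  rw [lintegral_add_measure, lintegral_smul_measure, lintegral_smul_measure, lintegral_dirac,
    lintegral_dirac, if_pos rfl, if_neg hab.symm, ENNReal.toReal_ofReal (by positivity),
    ENNReal.toReal_ofReal (by positivity), smul_eq_mul, smul_eq_mul,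
    ← ENNReal.ofReal_mul hq0.le, ← ENNReal.ofReal_mul hq1'.le,
    ← ENNReal.ofReal_add (by positivity) (by positivity)]
  congr 1
  field_simp
  ring

end Divergence

section Logarithm

lemma hasDerivAt_one_sub_two_mul_log_add_two_mul_log {x : ℝ} (hx0 : 0 < x) (hx1 : x < 1) :
    HasDerivAt (fun x => (1 - 2 * x) * Real.log (1 - x) + 2 * x * Real.log x)
      (2 * Real.log (x / (1 - x)) + 1 / (1 - x)) x := by
  have hx1' : 1 - x ≠ 0 := by linarith
  have hlin : HasDerivAt (fun x : ℝ => 1 - 2 * x) (-2) x := by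
    simpa using ((hasDerivAt_id x).const_mul 2).const_sub 1
  have hlog : HasDerivAt (fun x : ℝ => Real.log (1 - x)) (-1 / (1 - x)) x :=
    ((hasDerivAt_id x).const_sub 1).log hx1'
  have htwo : HasDerivAt (fun x : ℝ => 2 * x) 2 x := by
    simpa using (hasDerivAt_id x).const_mul 2
  refine ((hlin.mul hlog).add (htwo.mul (Real.hasDerivAt_log hx0.ne'))).congr_deriv ?_
  rw [Real.log_div hx0.ne' hx1']
  field_simp
  ring

lemma antitoneOn_one_sub_two_mul_log_add_two_mul_log :
    AntitoneOn (fun x : ℝ => (1 - 2 * x) * Real.log (1 - x) + 2 * x * Real.log x)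
      (Set.Ioc 0 0.15) := by
  have hderiv (x : ℝ) (hx : x ∈ Set.Ioc 0 0.15) :=
    hasDerivAt_one_sub_two_mul_log_add_two_mul_log hx.1 (by linarith [hx.2] : x < 1)
  refine antitoneOn_of_deriv_nonpos (convex_Ioc _ _)
    (fun x hx => (hderiv x hx).continuousAt.continuousWithinAt)
    (fun x hx => (hderiv x (interior_subset hx)).differentiableAt.differentiableWithinAt)
    (fun x hx => ?_)
  obtain ⟨hx0, hx1⟩ := interior_subset hx
  have hx1' : 0 < 1 - x := by linarith
  have hlog := Real.log_le_sub_one_of_pos (div_pos hx0 hx1')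
  have hodds : x / (1 - x) ≤ 3 / 17 := by
    rw [div_le_div_iff₀ hx1' (by norm_num)]
    linarith
  have hinv : 1 / (1 - x) ≤ 20 / 17 := by
    rw [div_le_div_iff₀ hx1' (by norm_num)]
    linarith
  rw [(hderiv x (interior_subset hx)).deriv]
  linarith

lemma neg_log_two_le_one_sub_two_mul_log_add_two_mul_log :
    -Real.log 2 ≤ (1 - 2 * 0.15) * Real.log (1 - 0.15) + 2 * 0.15 * Real.log 0.15 := by
  have hlog085 : Real.log (1 - 0.15) = Real.log 17 - Real.log 20 := by
    rw [← Real.log_div (by norm_num) (by norm_num)]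
    norm_num
  have hlog015 : Real.log 0.15 = Real.log 3 - Real.log 20 := by
    rw [← Real.log_div (by norm_num) (by norm_num)]
    norm_num
  have hlog20 : Real.log 20 = Real.log 2 + Real.log 10 := by
    rw [← Real.log_mul (by norm_num) (by norm_num)]
    norm_num
  have hpow : Real.log ((10 : ℝ) ^ 10) ≤ Real.log (17 ^ 7 * 3 ^ 3) :=
    Real.log_le_log (by norm_num) (by norm_num)
  rw [Real.log_mul (by norm_num) (by norm_num), Real.log_pow, Real.log_pow, Real.log_pow] at hpow
  rw [hlog085, hlog015, hlog20]
  push_cast at hpow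
  linarith

lemma log_one_div_two_mul_le {δ : ℝ} (hδ0 : 0 < δ) (hδ : δ ≤ 0.15) :
    Real.log (1 / (2 * δ)) ≤ (1 - 2 * δ) * Real.log ((1 - δ) / δ) := by
  have hanti := antitoneOn_one_sub_two_mul_log_add_two_mul_log ⟨hδ0, hδ⟩ ⟨by norm_num, le_rfl⟩ hδ
  have hend := neg_log_two_le_one_sub_two_mul_log_add_two_mul_log
  rw [one_div, Real.log_inv, Real.log_mul two_ne_zero hδ0.ne', Real.log_div (by linarith) hδ0.ne']
  dsimp only at hanti
  linarith

end Logarithm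

section Trajectory

open InformationTheory Preorder

variable {X : ℕ → Type*} [∀ n, MeasurableSpace (X n)]

lemma klDiv_map_frestrictLe_zero_le (P Q : Measure (∀ n, X n)) [IsFiniteMeasure P]
    [IsFiniteMeasure Q] :
    klDiv (P.map (frestrictLe 0)) (Q.map (frestrictLe 0))
      ≤ klDiv (P.map fun x => x 0) (Q.map fun x => x 0) := by
  let toHistory : X 0 → ∀ i : Finset.Iic 0, X i :=
    (MeasurableEquiv.piUnique fun i : Finset.Iic 0 => X i).symm
  have htoHistory : Measurable toHistory := MeasurableEquiv.measurable _
  have map_toHistory (ρ : Measure (∀ n, X n)) :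
      ρ.map (frestrictLe 0) = (ρ.map fun x => x 0).map toHistory := by
    rw [Measure.map_map htoHistory (by fun_prop)]
    congr 1
    ext x i
    obtain rfl := Unique.eq_default i
    rfl
  rw [map_toHistory, map_toHistory]
  exact klDiv_map_le _ _ htoHistory

lemma klDiv_map_frestrictLe_succ_le (P Q : Measure (∀ n, X n)) [IsFiniteMeasure P]
    [IsFiniteMeasure Q] {n : ℕ} {κ η : Kernel (∀ i : Finset.Iic n, X i) (X (n + 1))}
    [IsMarkovKernel κ] [IsMarkovKernel η]
    [MeasurableSpace.CountableOrCountablyGenerated (∀ i : Finset.Iic n, X i) (X (n + 1))]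
    (hP : P.map (frestrictLe n) ⊗ₘ κ = P.map fun x => (frestrictLe n x, x (n + 1)))
    (hQ : Q.map (frestrictLe n) ⊗ₘ η = Q.map fun x => (frestrictLe n x, x (n + 1))) :
    klDiv (P.map (frestrictLe (n + 1))) (Q.map (frestrictLe (n + 1)))
      ≤ klDiv (P.map (frestrictLe n)) (Q.map (frestrictLe n))
        + ∫⁻ h, klDiv (κ h) (η h) ∂(P.map (frestrictLe n)) := by
  let append (p : (∀ i : Finset.Iic n, X i) × X (n + 1)) : ∀ i : Finset.Iic (n + 1), X i :=
    IicProdIoc n (n + 1) (p.1, MeasurableEquiv.piSingleton n p.2)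
  have happend : Measurable append := by fun_prop
  have map_append (ρ : Measure (∀ n, X n)) :
      ρ.map (frestrictLe (n + 1)) = (ρ.map fun x => (frestrictLe n x, x (n + 1))).map append := by
    rw [Measure.map_map happend (by fun_prop)]
    congr 1
    ext x ⟨i, hi⟩
    obtain hin | rfl := Nat.le_succ_iff.1 (Finset.mem_Iic.1 hi)
    · simp [append, IicProdIoc, hin]
    · simp [append, IicProdIoc, MeasurableEquiv.piSingleton]
  rw [map_append, map_append, ← klDiv_compProd_right_eq_lintegral, ← klDiv_compProd_eq_add, hP, hQ]
  exact klDiv_map_le _ _ happend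

end Trajectory

section Interaction

open InformationTheory Preorder

variable {K : ℕ} {τ : ℝ}

instance : DiscreteMeasurableSpace (Decision K) := ⟨fun _ => trivial⟩

instance : Countable (Decision K) := by
  refine Function.Injective.countable (β := Fin K ⊕ (Fin K × Fin K) ⊕ Finset (Fin K))
    (f := fun
      | .pull i => .inl i
      | .duel i j => .inr (.inl (i, j))
      | .halt S => .inr (.inr S)) ?_
  rintro (_ | _ | _) (_ | _ | _) h <;> simp_all

namespace Algorithm

instance (A : Algorithm K) (I : Problem K τ) (R : ℝ≥0) : IsProbabilityMeasure (A.law I R) := by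
  unfold law
  infer_instance

lemma step_apply (A : Algorithm K) (I : Problem K τ) (R : ℝ≥0) (n : ℕ)
    (h : Finset.Iic n → Round K) : A.step I R n h = A.next n h ⊗ₘ obs I R := by
  rw [step, Kernel.compProd_apply_eq_compProd_sectR, Kernel.sectR_prodMkLeft]

/-- `P` is a law of the sequence of rounds of `A` on the instance `I`, described by the law of the
first round and the conditional law of every round given the previous ones. -/
structure IsInteractionLaw (A : Algorithm K) (I : Problem K τ) (R : ℝ≥0)
    (P : Measure (ℕ → Round K)) : Prop where
  map_zero : P.map (fun ω => ω 0) = A.first ⊗ₘ obs I R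
  map_succ (n : ℕ) : P.map (frestrictLe n) ⊗ₘ A.step I R n
    = P.map fun ω => (frestrictLe n ω, ω (n + 1))

lemma isInteractionLaw_law (A : Algorithm K) (I : Problem K τ) (R : ℝ≥0) :
    A.IsInteractionLaw I R (A.law I R) where
  map_zero := by
    have h : (fun ω : ℕ → Round K => ω 0)
        = (fun h : Finset.Iic 0 → Round K => h ⟨0, by simp⟩) ∘ frestrictLe 0 := rfl
    rw [h, ← Measure.map_map (by fun_prop) (by fun_prop), law, Kernel.trajMeasure,
      Measure.map_comp _ _ (by fun_prop), Kernel.traj_map_frestrictLe, Kernel.partialTraj_self,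
      Measure.id_comp, Measure.map_map (by fun_prop) (by fun_prop)]
    exact Measure.map_id
  map_succ _ := Kernel.map_frestrictLe_trajMeasure_compProd_eq_map_trajMeasure

lemma measurable_klDiv_obs_fst (I J : Problem K τ) (R : ℝ≥0) :
    Measurable fun x : Round K => klDiv (obs I R x.1) (obs J R x.1) :=
  (Measurable.of_discrete (f := fun d => klDiv (obs I R d) (obs J R d))).comp measurable_fst

lemma klDiv_compProd_obs (ρ : Measure (Decision K)) [IsFiniteMeasure ρ] (I J : Problem K τ)
    (R : ℝ≥0) :
    klDiv (ρ ⊗ₘ obs I R) (ρ ⊗ₘ obs J R)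
      = ∫⁻ x, klDiv (obs I R x.1) (obs J R x.1) ∂(ρ ⊗ₘ obs I R) := by
  rw [klDiv_compProd_right_eq_lintegral,
    Measure.lintegral_compProd (measurable_klDiv_obs_fst I J R)]
  simp

namespace IsInteractionLaw

variable {A : Algorithm K} {I J : Problem K τ} {R : ℝ≥0} {P Q : Measure (ℕ → Round K)}

lemma klDiv_map_zero (hP : A.IsInteractionLaw I R P) (hQ : A.IsInteractionLaw J R Q) :
    klDiv (P.map fun ω => ω 0) (Q.map fun ω => ω 0)
      = ∫⁻ ω, klDiv (obs I R (ω 0).1) (obs J R (ω 0).1) ∂P := by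
  rw [hP.map_zero, hQ.map_zero, klDiv_compProd_obs, ← hP.map_zero,
    lintegral_map (measurable_klDiv_obs_fst I J R) (by fun_prop)]

variable [IsFiniteMeasure P]

lemma lintegral_klDiv_step (hP : A.IsInteractionLaw I R P) (J : Problem K τ) (n : ℕ) :
    ∫⁻ h, klDiv (A.step I R n h) (A.step J R n h) ∂(P.map (frestrictLe n))
      = ∫⁻ ω, klDiv (obs I R (ω (n + 1)).1) (obs J R (ω (n + 1)).1) ∂P := by
  have hmeas : Measurable fun p : (Finset.Iic n → Round K) × Round K =>
      klDiv (obs I R p.2.1) (obs J R p.2.1) := (measurable_klDiv_obs_fst I J R).comp measurable_snd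
  calc
    _ = ∫⁻ h, ∫⁻ x, klDiv (obs I R x.1) (obs J R x.1) ∂A.step I R n h
          ∂(P.map (frestrictLe n)) := by
      simp_rw [step_apply, klDiv_compProd_obs]
    _ = ∫⁻ p, klDiv (obs I R p.2.1) (obs J R p.2.1) ∂(P.map (frestrictLe n) ⊗ₘ A.step I R n) :=
      (Measure.lintegral_compProd hmeas).symm
    _ = ∫⁻ ω, klDiv (obs I R (ω (n + 1)).1) (obs J R (ω (n + 1)).1) ∂P := by
      rw [hP.map_succ]
      exact lintegral_map hmeas (by fun_prop)

variable [IsFiniteMeasure Q]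

lemma klDiv_map_frestrictLe_le (hP : A.IsInteractionLaw I R P) (hQ : A.IsInteractionLaw J R Q)
    (n : ℕ) :
    klDiv (P.map (frestrictLe n)) (Q.map (frestrictLe n))
      ≤ ∑ t ∈ Finset.range (n + 1), ∫⁻ ω, klDiv (obs I R (ω t).1) (obs J R (ω t).1) ∂P := by
  induction n with
  | zero =>
    rw [zero_add, Finset.sum_range_one, ← hP.klDiv_map_zero hQ]
    exact klDiv_map_frestrictLe_zero_le P Q
  | succ n ih =>
    rw [Finset.sum_range_succ, ← hP.lintegral_klDiv_step]
    exact (klDiv_map_frestrictLe_succ_le P Q (hP.map_succ n) (hQ.map_succ n)).trans (by gcongr)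

end IsInteractionLaw

end Algorithm

end Interaction

section Freezing

variable {K : ℕ}

open Classical in
/-- The rounds of `ω` up to stopping, after which the halting decision is repeated forever. -/
def freeze (ω : ℕ → Round K) : ℕ → Round K
  | 0 => ω 0
  | t + 1 => if (freeze ω t).1.Active then ω (t + 1) else ((freeze ω t).1, 0)

lemma freeze_succ_of_active {ω : ℕ → Round K} {t : ℕ} (h : (freeze ω t).1.Active) :
    freeze ω (t + 1) = ω (t + 1) := if_pos h

lemma freeze_succ_of_not_active {ω : ℕ → Round K} {t : ℕ} (h : ¬(freeze ω t).1.Active) :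
    freeze ω (t + 1) = ((freeze ω t).1, 0) := if_neg h

lemma RunningAt.mono {ω : ℕ → Round K} {s t : ℕ} (h : RunningAt ω t) (hst : s ≤ t) :
    RunningAt ω s := fun r hr => h r (hr.trans_le hst)

lemma RunningAt.freeze_eq {ω : ℕ → Round K} {t : ℕ} (h : RunningAt ω t) :
    freeze ω t = ω t := by
  induction t with
  | zero => rfl
  | succ t ih =>
    exact freeze_succ_of_active (ih (h.mono t.le_succ) ▸ h t t.lt_succ_self)

lemma active_freeze_iff {ω : ℕ → Round K} {t : ℕ} :
    (freeze ω t).1.Active ↔ RunningAt ω (t + 1) := by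
  refine ⟨fun h => ?_, fun h => (h.mono t.le_succ).freeze_eq ▸ h t t.lt_succ_self⟩
  induction t with
  | zero =>
    intro s hs
    rwa [Nat.lt_one_iff.1 hs]
  | succ t ih =>
    by_cases ht : (freeze ω t).1.Active
    · rw [freeze_succ_of_active ht] at h
      intro s hs
      obtain hs | rfl := Nat.lt_succ_iff_lt_or_eq.1 hs
      · exact ih ht s hs
      · exact h
    · rw [freeze_succ_of_not_active ht] at h
      exact absurd h ht

lemma runningAt_of_active_freeze {ω : ℕ → Round K} {t : ℕ} (h : (freeze ω t).1.Active) :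
    RunningAt ω t :=
  (active_freeze_iff.1 h).mono t.le_succ

@[fun_prop]
lemma measurable_freeze : Measurable (freeze (K := K)) := by
  refine measurable_pi_lambda _ fun t => ?_
  induction t with
  | zero => exact measurable_pi_apply 0
  | succ t ih =>
    exact Measurable.ite (ih.fst (MeasurableSet.of_discrete (s := {d : Decision K | d.Active})))
      (measurable_pi_apply _) (ih.fst.prodMk measurable_const)

lemma halt_not_active (S : Finset (Fin K)) : ¬(Decision.halt S).Active := id

lemma exists_eq_halt_of_not_active {d : Decision K} (h : ¬d.Active) : ∃ S, d = .halt S := by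
  cases d with
  | halt S => exact ⟨S, rfl⟩
  | pull i => exact absurd trivial h
  | duel i j => exact absurd trivial h

lemma monotone_freeze_eq_halt (ω : ℕ → Round K) (S : Finset (Fin K)) :
    Monotone fun t => (freeze ω t).1 = .halt S := by
  refine monotone_nat_of_le_succ fun t (ht : (freeze ω t).1 = .halt S) => ?_
  rw [freeze_succ_of_not_active (ht ▸ halt_not_active S), ht]

lemma outputs_iff_exists_freeze_eq_halt {ω : ℕ → Round K} {S : Finset (Fin K)} :
    Outputs S ω ↔ ∃ t, (freeze ω t).1 = .halt S := by
  refine ⟨fun ⟨t, hrun, ht⟩ => ⟨t, hrun.freeze_eq ▸ ht⟩, fun ⟨t, ht⟩ => ?_⟩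
  induction t with
  | zero => exact ⟨0, fun s hs => absurd hs s.not_lt_zero, ht⟩
  | succ t ih =>
    by_cases hact : (freeze ω t).1.Active
    · exact ⟨t + 1, active_freeze_iff.1 hact, freeze_succ_of_active hact ▸ ht⟩
    · exact ih (by rwa [freeze_succ_of_not_active hact] at ht)

lemma Outputs.eq {ω : ℕ → Round K} {S S' : Finset (Fin K)} (h : Outputs S ω)
    (h' : Outputs S' ω) : S = S' := by
  obtain ⟨t, ht⟩ := outputs_iff_exists_freeze_eq_halt.1 h
  obtain ⟨t', ht'⟩ := outputs_iff_exists_freeze_eq_halt.1 h'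
  have hS := monotone_freeze_eq_halt ω S (le_max_left t t') ht
  have hS' := monotone_freeze_eq_halt ω S' (le_max_right t t') ht'
  exact Decision.halt.inj (hS.symm.trans hS')

lemma setOf_outputs_eq_iUnion (S : Finset (Fin K)) :
    {ω | Outputs S ω} = ⋃ t, {ω | (freeze ω t).1 = .halt S} := by
  ext ω
  simp [outputs_iff_exists_freeze_eq_halt]

lemma measurableSet_freeze_eq_halt (S : Finset (Fin K)) (t : ℕ) :
    MeasurableSet {ω | (freeze ω t).1 = .halt S} :=
  measurable_fst.comp ((measurable_pi_apply t).comp measurable_freeze)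
    (measurableSet_singleton (Decision.halt S))

lemma measurableSet_outputs (S : Finset (Fin K)) : MeasurableSet {ω | Outputs S ω} :=
  setOf_outputs_eq_iUnion S ▸ MeasurableSet.iUnion (measurableSet_freeze_eq_halt S)

lemma tendsto_measureReal_freeze_eq_halt (P : Measure (ℕ → Round K)) [IsFiniteMeasure P]
    (S : Finset (Fin K)) :
    Filter.Tendsto (fun t => P.real {ω | (freeze ω t).1 = .halt S}) Filter.atTop
      (nhds (P.real {ω | Outputs S ω})) := by
  rw [setOf_outputs_eq_iUnion]
  exact (ENNReal.tendsto_toReal (measure_ne_top _ _)).comp <|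
    tendsto_measure_iUnion_atTop fun s t hst ω => monotone_freeze_eq_halt ω S hst

end Freezing

section Stopped

open Preorder

variable {K : ℕ} {τ : ℝ}

lemma setLIntegral_kernel_eq_of_map_compProd_eq {Ω α β : Type*} {mΩ : MeasurableSpace Ω}
    {mα : MeasurableSpace α} {mβ : MeasurableSpace β} {ρ : Measure Ω} [SFinite ρ] {r : Ω → α}
    {y : Ω → β} (hr : Measurable r) (hy : Measurable y) {κ : Kernel α β} [IsSFiniteKernel κ]
    (hκ : ρ.map r ⊗ₘ κ = ρ.map fun ω => (r ω, y ω)) {f : α × β → ℝ≥0∞} (hf : Measurable f)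
    {C : Set α} (hC : MeasurableSet C) :
    ∫⁻ ω in r ⁻¹' C, ∫⁻ x, f (r ω, x) ∂κ (r ω) ∂ρ = ∫⁻ ω in r ⁻¹' C, f (r ω, y ω) ∂ρ := by
  calc
    _ = ∫⁻ a in C, ∫⁻ x, f (a, x) ∂κ a ∂(ρ.map r) := by
      rw [setLIntegral_map hC (Measurable.lintegral_kernel_prod_right' hf) hr]
    _ = ∫⁻ p in C ×ˢ Set.univ, f p ∂(ρ.map r ⊗ₘ κ) := by
      rw [Measure.setLIntegral_compProd hf hC MeasurableSet.univ]
      simp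
    _ = ∫⁻ ω in r ⁻¹' C, f (r ω, y ω) ∂ρ := by
      rw [hκ, setLIntegral_map (hC.prod MeasurableSet.univ) hf (by fun_prop), Set.mk_preimage_prod,
        Set.preimage_univ, Set.inter_univ]

/-- The last round of a history. -/
def lastRound {n : ℕ} (h : Finset.Iic n → Round K) : Round K := h ⟨n, Finset.mem_Iic.2 le_rfl⟩

@[fun_prop]
lemma measurable_lastRound {n : ℕ} : Measurable (lastRound (K := K) (n := n)) :=
  measurable_pi_apply _

lemma measurableSet_active_lastRound (n : ℕ) :
    MeasurableSet {h : Finset.Iic n → Round K | (lastRound h).1.Active} :=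
  measurable_lastRound.fst (MeasurableSet.of_discrete (s := {d : Decision K | d.Active}))

/-- The histories of the rounds `0, …, n` in which no decision is a `halt`. -/
def activeHistories (K n : ℕ) : Set (Finset.Iic n → Round K) := {h | ∀ i, (h i).1.Active}

lemma measurableSet_activeHistories (n : ℕ) : MeasurableSet (activeHistories K n) := by
  rw [activeHistories, Set.ofPred_forall]
  exact .iInter fun i =>
    (measurable_pi_apply i).fst (MeasurableSet.of_discrete (s := {d : Decision K | d.Active}))

lemma frestrictLe_mem_activeHistories_iff {ω : ℕ → Round K} {n : ℕ} :
    frestrictLe n ω ∈ activeHistories K n ↔ (freeze ω n).1.Active := by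
  rw [active_freeze_iff]
  exact ⟨fun h s hs => h ⟨s, Finset.mem_Iic.2 (Nat.lt_succ_iff.1 hs)⟩,
    fun h i => h i (Nat.lt_succ_iff.2 (Finset.mem_Iic.1 i.2))⟩

lemma frestrictLe_freeze_of_mem {ω : ℕ → Round K} {n : ℕ}
    (h : frestrictLe n ω ∈ activeHistories K n) :
    frestrictLe n (freeze ω) = frestrictLe (π := fun _ => Round K) n ω :=
  have hrun := runningAt_of_active_freeze (frestrictLe_mem_activeHistories_iff.1 h)
  funext fun i => (hrun.mono (Finset.mem_Iic.1 i.2)).freeze_eq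

namespace Algorithm

open Classical in
/-- The algorithm that plays like `A` until it halts and then repeats the halting decision. -/
def stopped (A : Algorithm K) : Algorithm K where
  first := A.first
  isProbabilityMeasure_first := inferInstance
  next n := Kernel.piecewise (measurableSet_active_lastRound n) (A.next n)
    (Kernel.deterministic (fun h => (lastRound h).1) measurable_lastRound.fst)
  isMarkovKernel_next _ := inferInstance

lemma step_stopped_of_active (A : Algorithm K) (I : Problem K τ) (R : ℝ≥0) {n : ℕ}
    {h : Finset.Iic n → Round K} (hact : (lastRound h).1.Active) :
    A.stopped.step I R n h = A.step I R n h := by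
  have hnext : A.stopped.next n h = A.next n h := if_pos hact
  rw [step_apply, step_apply, hnext]

lemma step_stopped_of_not_active (A : Algorithm K) (I : Problem K τ) (R : ℝ≥0) {n : ℕ}
    {h : Finset.Iic n → Round K} (hact : ¬(lastRound h).1.Active) :
    A.stopped.step I R n h = Measure.dirac ((lastRound h).1, 0) := by
  have hnext : A.stopped.next n h = Measure.dirac (lastRound h).1 := if_neg hact
  obtain ⟨S, hS⟩ := exists_eq_halt_of_not_active hact
  have hobs : obs I R (.halt S) = Measure.dirac 0 := rfl
  rw [step_apply, hnext, hS, Measure.compProd_eq_comp_prod,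
    Measure.dirac_bind (Kernel.measurable _), Kernel.prod_apply, hobs, Kernel.id_apply,
    Measure.dirac_prod_dirac]

/-- The law of the frozen sequence of rounds of `A` on the instance `I`. -/
def stoppedLaw (A : Algorithm K) (I : Problem K τ) (R : ℝ≥0) : Measure (ℕ → Round K) :=
  (A.law I R).map freeze

instance (A : Algorithm K) (I : Problem K τ) (R : ℝ≥0) :
    IsProbabilityMeasure (A.stoppedLaw I R) :=
  Measure.isProbabilityMeasure_map measurable_freeze.aemeasurable

lemma lintegral_step_stopped (A : Algorithm K) (I : Problem K τ) (R : ℝ≥0) (n : ℕ)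
    {f : (Finset.Iic n → Round K) × Round K → ℝ≥0∞} (hf : Measurable f) :
    ∫⁻ ω, ∫⁻ x, f (frestrictLe n (freeze ω), x) ∂A.stopped.step I R n (frestrictLe n (freeze ω))
        ∂A.law I R
      = ∫⁻ ω, f (frestrictLe n (freeze ω), freeze ω (n + 1)) ∂A.law I R := by
  have hC : MeasurableSet (frestrictLe n ⁻¹' activeHistories K n : Set (ℕ → Round K)) :=
    (measurableSet_activeHistories n).preimage (measurable_frestrictLe n)
  rw [← lintegral_add_compl _ hC, ← lintegral_add_compl (fun ω => f _) hC]
  congr 1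
  · calc
      _ = ∫⁻ ω in frestrictLe n ⁻¹' activeHistories K n,
            ∫⁻ x, f (frestrictLe n ω, x) ∂A.step I R n (frestrictLe n ω) ∂A.law I R := by
        refine setLIntegral_congr_fun hC fun ω hω => ?_
        have hact : (lastRound (frestrictLe n (freeze ω))).1.Active :=
          frestrictLe_mem_activeHistories_iff.1 hω
        rw [A.step_stopped_of_active I R hact, frestrictLe_freeze_of_mem hω]
      _ = ∫⁻ ω in frestrictLe n ⁻¹' activeHistories K n, f (frestrictLe n ω, ω (n + 1))
            ∂A.law I R :=
        setLIntegral_kernel_eq_of_map_compProd_eq (by fun_prop) (by fun_prop)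
          ((A.isInteractionLaw_law I R).map_succ n) hf (measurableSet_activeHistories n)
      _ = _ := by
        refine setLIntegral_congr_fun hC fun ω hω => ?_
        simp only [frestrictLe_freeze_of_mem hω,
          freeze_succ_of_active (frestrictLe_mem_activeHistories_iff.1 hω)]
  · refine setLIntegral_congr_fun hC.compl fun ω hω => ?_
    have hact : ¬(lastRound (frestrictLe n (freeze ω))).1.Active :=
      fun h => hω (frestrictLe_mem_activeHistories_iff.2 h)
    simp only [A.step_stopped_of_not_active I R hact, freeze_succ_of_not_active hact]
    exact lintegral_dirac' _ (by fun_prop)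

lemma isInteractionLaw_stoppedLaw (A : Algorithm K) (I : Problem K τ) (R : ℝ≥0) :
    A.stopped.IsInteractionLaw I R (A.stoppedLaw I R) where
  map_zero := by
    rw [stoppedLaw, Measure.map_map (by fun_prop) (by fun_prop)]
    exact (A.isInteractionLaw_law I R).map_zero
  map_succ n := by
    refine Measure.ext_of_lintegral _ fun f hf => ?_
    have hint : Measurable fun h => ∫⁻ x, f (h, x) ∂A.stopped.step I R n h :=
      hf.lintegral_kernel_prod_right'
    rw [stoppedLaw, Measure.map_map (by fun_prop) (by fun_prop),
      Measure.map_map (by fun_prop) (by fun_prop), Measure.lintegral_compProd hf,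
      lintegral_map hint (by fun_prop), lintegral_map hf (by fun_prop)]
    exact A.lintegral_step_stopped I R n hf

end Algorithm

end Stopped

section Counting

variable {K : ℕ}

open Classical in
/-- The number of rounds before round `n` whose decision satisfies `p`. -/
def countUpTo (p : Decision K → Prop) (n : ℕ) (ω : ℕ → Round K) : ℝ≥0∞ :=
  ∑ t ∈ Finset.range n, if p (ω t).1 then 1 else 0

@[fun_prop]
lemma measurable_countUpTo (p : Decision K → Prop) (n : ℕ) : Measurable (countUpTo p n) := by
  classical
  exact Finset.measurable_sum _ fun t _ => Measurable.ite
    ((measurable_pi_apply t).fst (MeasurableSet.of_discrete (s := {d | p d})))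
    measurable_const measurable_const

lemma countUpTo_le (p : Decision K → Prop) (n : ℕ) (ω : ℕ → Round K) :
    countUpTo p n ω ≤ n := by
  classical
  calc
    countUpTo p n ω ≤ ∑ _t ∈ Finset.range n, (1 : ℝ≥0∞) :=
      Finset.sum_le_sum fun t _ => ite_le_one le_rfl zero_le_one
    _ = n := by simp

lemma lintegral_countUpTo_ne_top (P : Measure (ℕ → Round K)) [IsFiniteMeasure P]
    (p : Decision K → Prop) (n : ℕ) : ∫⁻ ω, countUpTo p n ω ∂P ≠ ∞ := by
  refine ne_top_of_le_ne_top ?_ (lintegral_mono (countUpTo_le p n))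
  rw [lintegral_const]
  finiteness

open Classical in
lemma countUpTo_freeze_le_tsum {p : Decision K → Prop} (hp : ∀ d, p d → d.Active) (n : ℕ)
    (ω : ℕ → Round K) :
    countUpTo p n (freeze ω) ≤ ∑' t, if RunningAt ω t ∧ p (ω t).1 then 1 else 0 := by
  refine le_trans (Finset.sum_le_sum fun t _ => ?_) (ENNReal.sum_le_tsum (Finset.range n))
  by_cases ht : p (freeze ω t).1
  · have hrun := runningAt_of_active_freeze (hp _ ht)
    rw [if_pos ht, if_pos ⟨hrun, hrun.freeze_eq ▸ ht⟩]
  · rw [if_neg ht]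
    exact zero_le

lemma countUpTo_freeze_le_numDuels (k : Fin K) (n : ℕ) (ω : ℕ → Round K) :
    countUpTo (Decision.IsDuelOf k) n (freeze ω) ≤ numDuels k ω :=
  countUpTo_freeze_le_tsum (by rintro (_ | _ | _) h <;> trivial) n ω

lemma countUpTo_freeze_le_numPulls (k : Fin K) (n : ℕ) (ω : ℕ → Round K) :
    countUpTo (Decision.IsPullOf k) n (freeze ω) ≤ numPulls k ω :=
  countUpTo_freeze_le_tsum (by rintro (_ | _ | _) h <;> trivial) n ω

open Classical in
lemma sum_lintegral_le_of_le_ite (P : Measure (ℕ → Round K)) [IsProbabilityMeasure P]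
    {c : Decision K → ℝ≥0∞} {p q : Decision K → Prop} {a b e : ℝ≥0∞}
    (hc : ∀ d, c d ≤ (if p d then a else 0) + (if q d then b else 0) + e) (n : ℕ) :
    ∑ t ∈ Finset.range n, ∫⁻ ω, c (ω t).1 ∂P
      ≤ a * ∫⁻ ω, countUpTo p n ω ∂P + b * ∫⁻ ω, countUpTo q n ω ∂P + n * e := by
  have hmeas (t : ℕ) : Measurable fun ω : ℕ → Round K => c (ω t).1 :=
    (Measurable.of_discrete (f := c)).comp (measurable_pi_apply t).fst
  calc
    _ = ∫⁻ ω, ∑ t ∈ Finset.range n, c (ω t).1 ∂P :=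
      (lintegral_finsetSum _ fun t _ => hmeas t).symm
    _ ≤ ∫⁻ ω, (a * countUpTo p n ω + b * countUpTo q n ω + n * e) ∂P := by
      refine lintegral_mono fun ω => (Finset.sum_le_sum fun t _ => hc (ω t).1).trans_eq ?_
      simp only [countUpTo, Finset.sum_add_distrib, Finset.mul_sum, mul_ite, mul_one, mul_zero,
        Finset.sum_const, Finset.card_range, nsmul_eq_mul]
    _ = _ := by
      rw [lintegral_add_right _ measurable_const, lintegral_add_right _ (by fun_prop),
        lintegral_const_mul _ (by fun_prop), lintegral_const_mul _ (by fun_prop),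
        lintegral_const, measure_univ, mul_one]

end Counting

section Scores

variable {K : ℕ} {τ : ℝ}

lemma natCast_sub_one_pos (hK : 2 ≤ K) : (0 : ℝ) < K - 1 :=
  sub_pos.2 (Nat.one_lt_cast.2 hK)

lemma card_univ_erase (i : Fin K) : ((Finset.univ.erase i).card : ℝ) = K - 1 := by
  rw [Finset.cast_card_erase_of_mem (Finset.mem_univ i), Finset.card_univ, Fintype.card_fin]

lemma le_score (hK : 2 ≤ K) {M : Fin K → Fin K → ℝ} {a : ℝ} {i : Fin K} (h : ∀ j, a ≤ M i j) :
    a ≤ score M i := by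
  rw [score, one_div_mul_eq_div, le_div_iff₀ (natCast_sub_one_pos hK), ← card_univ_erase i,
    mul_comm, ← nsmul_eq_mul]
  exact Finset.card_nsmul_le_sum _ _ _ fun j _ => h j

lemma score_le (hK : 2 ≤ K) {M : Fin K → Fin K → ℝ} {a : ℝ} {i : Fin K} (h : ∀ j, M i j ≤ a) :
    score M i ≤ a := by
  rw [score, one_div_mul_eq_div, div_le_iff₀ (natCast_sub_one_pos hK), ← card_univ_erase i,
    mul_comm, ← nsmul_eq_mul]
  exact Finset.sum_le_card_nsmul _ _ _ fun j _ => h j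

namespace Problem

lemma score_sub_duelGap_le (I : Problem K τ) {k i : Fin K} (hk : τ ≤ I.μ k) (hi : τ ≤ I.μ i) :
    score I.M k - I.duelGap k ≤ score I.M i := by
  rw [duelGap, if_pos hk, sub_sub_cancel]
  exact ciInf_le (Set.finite_range _).bddBelow (⟨i, hi⟩ : {j : Fin K // τ ≤ I.μ j})

lemma duelGap_nonneg (I : Problem K τ) {k : Fin K} (hk : τ ≤ I.μ k) : 0 ≤ I.duelGap k := by
  linarith [I.score_sub_duelGap_le hk hk]

lemma M_le_one_sub (I : Problem K τ) {a : ℝ} (hM : ∀ i j, a ≤ I.M i j) (i j : Fin K) :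
    I.M i j ≤ 1 - a := by
  linarith [hM j i, I.M_add_swap i j]

lemma duelGap_le (I : Problem K τ) (hK : 2 ≤ K) {a : ℝ} (hM : ∀ i j, a ≤ I.M i j) {k : Fin K}
    (hk : τ ≤ I.μ k) : I.duelGap k ≤ 1 - 2 * a := by
  have hscore : score I.M k ≤ 1 - a := score_le hK (I.M_le_one_sub hM k)
  have : Nonempty {j : Fin K // τ ≤ I.μ j} := ⟨⟨k, hk⟩⟩
  have hinf : a ≤ ⨅ j : {j : Fin K // τ ≤ I.μ j}, score I.M j :=
    le_ciInf fun j => le_score hK (hM j)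
  rw [duelGap, if_pos hk]
  linarith

end Problem

end Scores

section Alternative

open InformationTheory

variable {K : ℕ} {τ : ℝ}

/-- The preference matrix `M` with the winning probabilities of arm `k` lowered by `d`. -/
def lowerRow (M : Fin K → Fin K → ℝ) (k : Fin K) (d : ℝ) (i j : Fin K) : ℝ :=
  M i j + ((if j = k then d else 0) - if i = k then d else 0)

/-- The mean vector `μ` with the mean of arm `k` moved to `τ - ε` and the other means that are at
least `τ` raised by `ε`, so that none of them equals `τ`. -/
def lowerMean (τ : ℝ) (μ : Fin K → ℝ) (k : Fin K) (ε : ℝ) (i : Fin K) : ℝ :=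
  if i = k then τ - ε else if τ ≤ μ i then μ i + ε else μ i

lemma lowerRow_swap (M : Fin K → Fin K → ℝ) (k : Fin K) (d : ℝ) (i j : Fin K) :
    lowerRow M k d i j + lowerRow M k d j i = M i j + M j i := by
  simp only [lowerRow]
  ring

lemma score_lowerRow_self (hK : 2 ≤ K) (M : Fin K → Fin K → ℝ) (k : Fin K) (d : ℝ) :
    score (lowerRow M k d) k = score M k - d := by
  have hsum : ∑ j ∈ Finset.univ.erase k, lowerRow M k d k j
      = ∑ j ∈ Finset.univ.erase k, M k j - (K - 1) * d := by
    simp only [lowerRow, if_true, Finset.sum_add_distrib, Finset.sum_sub_distrib,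
      Finset.sum_ite_eq', Finset.notMem_erase, if_false, Finset.sum_const, nsmul_eq_mul,
      card_univ_erase]
    ring
  have hK' := natCast_sub_one_pos hK
  rw [score, score, hsum]
  field_simp

lemma score_lowerRow_of_ne (M : Fin K → Fin K → ℝ) {i k : Fin K} (hik : i ≠ k) (d : ℝ) :
    score (lowerRow M k d) i = score M i + 1 / ((K : ℝ) - 1) * d := by
  have hsum : ∑ j ∈ Finset.univ.erase i, lowerRow M k d i j
      = ∑ j ∈ Finset.univ.erase i, M i j + d := by
    have hk : k ∈ Finset.univ.erase i := Finset.mem_erase.2 ⟨hik.symm, Finset.mem_univ k⟩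
    simp only [lowerRow, if_neg hik, sub_zero, Finset.sum_add_distrib, Finset.sum_ite_eq',
      if_pos hk]
  rw [score, score, hsum, mul_add]

lemma lowerMean_ne (μ : Fin K → ℝ) (k : Fin K) {ε : ℝ} (hε : 0 < ε) (i : Fin K) :
    lowerMean τ μ k ε i ≠ τ := by
  unfold lowerMean
  split_ifs with hik hi
  · exact (sub_lt_self τ hε).ne
  · exact (lt_add_of_le_of_pos hi hε).ne'
  · exact fun h => hi h.ge

lemma lowerMean_self (μ : Fin K → ℝ) (k : Fin K) (ε : ℝ) : lowerMean τ μ k ε k = τ - ε :=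
  if_pos rfl

lemma abs_sub_lowerMean_le_of_ne (μ : Fin K → ℝ) {i k : Fin K} (hik : i ≠ k) {ε : ℝ}
    (hε : 0 < ε) : |μ i - lowerMean τ μ k ε i| ≤ ε := by
  rw [lowerMean, if_neg hik]
  split_ifs
  · simp [abs_of_pos hε]
  · simp [hε.le]

lemma le_lowerMean_iff {μ : Fin K → ℝ} {i k : Fin K} {ε : ℝ} (hε : 0 < ε) :
    τ ≤ lowerMean τ μ k ε i ↔ i ≠ k ∧ τ ≤ μ i := by
  unfold lowerMean
  split_ifs <;> grind

lemma lowerRow_nonneg {M : Fin K → Fin K → ℝ} (hM : ∀ i j, 0 ≤ M i j) {k : Fin K} {d : ℝ}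
    (hd : 0 ≤ d) (hdM : ∀ j, d ≤ M k j) (i j : Fin K) : 0 ≤ lowerRow M k d i j := by
  have := hM i j
  have := hdM j
  grind [lowerRow]

lemma Problem.exists_lower (I : Problem K τ) (hK : 2 ≤ K) {k : Fin K} {ε d : ℝ} (hε : 0 < ε)
    (hd0 : 0 ≤ d) (hd : ∀ i, τ ≤ I.μ i → score I.M k - d < score I.M i)
    (hdM : ∀ j, d ≤ I.M k j) :
    ∃ J : Problem K τ, J.μ = lowerMean τ I.μ k ε ∧ J.M = lowerRow I.M k d := by
  refine ⟨⟨_, _, lowerRow_nonneg I.M_nonneg hd0 hdM,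
    fun i j => (lowerRow_swap I.M k d i j).trans (I.M_add_swap i j), fun i j hi' hj' => ?_⟩,
    rfl, rfl⟩
  obtain ⟨hik, hi⟩ := (le_lowerMean_iff hε).1 hi'
  rw [score_lowerRow_of_ne _ hik]
  obtain rfl | hjk := eq_or_ne j k
  · have := natCast_sub_one_pos hK
    have hgain : 0 ≤ 1 / ((K : ℝ) - 1) * d := by positivity
    rw [score_lowerRow_self hK]
    linarith [hd i hi]
  · have hj : I.μ j < τ := lt_of_not_ge fun h => hj'.not_ge ((le_lowerMean_iff hε).2 ⟨hjk, h⟩)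
    rw [score_lowerRow_of_ne _ hjk]
    linarith [I.score_lt i j hi hj]

lemma klDiv_obs_pull (I J : Problem K τ) {R : ℝ≥0} (hR : 0 < R) (i : Fin K) :
    klDiv (obs I R (.pull i)) (obs J R (.pull i))
      = ENNReal.ofReal ((I.μ i - J.μ i) ^ 2 / (2 * (R : ℝ) ^ 2)) :=
  klDiv_gaussianReal_same_variance (I.μ i) (J.μ i) (pow_ne_zero 2 hR.ne')

lemma klDiv_obs_duel_le (I J : Problem K τ) (R : ℝ≥0) {i j : Fin K} (h0 : 0 < J.M i j)
    (h1 : J.M i j < 1) :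
    klDiv (obs I R (.duel i j)) (obs J R (.duel i j))
      ≤ ENNReal.ofReal ((I.M i j - J.M i j) ^ 2 / (J.M i j * (1 - J.M i j))) :=
  klDiv_two_point_le one_ne_zero (I.M_nonneg i j)
    (by linarith [I.M_nonneg j i, I.M_add_swap i j]) h0 h1

lemma klDiv_obs_halt (I J : Problem K τ) (R : ℝ≥0) (S : Finset (Fin K)) :
    klDiv (obs I R (.halt S)) (obs J R (.halt S)) = 0 :=
  klDiv_self (Measure.dirac (0 : ℝ))

section Lower

variable {I J : Problem K τ} {k : Fin K} {ε d : ℝ}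

lemma notMem_posSet_of_lowerMean (hμ : J.μ = lowerMean τ I.μ k ε) (hε : 0 < ε) :
    k ∉ J.posSet := by
  simp [Problem.posSet, hμ, lowerMean_self, hε]

lemma klDiv_obs_pull_self (hμ : J.μ = lowerMean τ I.μ k ε) {R : ℝ≥0} (hR : 0 < R)
    (hk : τ ≤ I.μ k) :
    klDiv (obs I R (.pull k)) (obs J R (.pull k))
      = ENNReal.ofReal ((I.pullGap k + ε) ^ 2 / (2 * (R : ℝ) ^ 2)) := by
  rw [klDiv_obs_pull I J hR, hμ, lowerMean_self, Problem.pullGap, abs_of_nonneg (sub_nonneg.2 hk),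
    sub_sub_eq_add_sub, add_sub_right_comm]

lemma klDiv_obs_pull_le_of_ne (hμ : J.μ = lowerMean τ I.μ k ε) {R : ℝ≥0} (hR : 0 < R)
    (hε : 0 < ε) {i : Fin K} (hik : i ≠ k) :
    klDiv (obs I R (.pull i)) (obs J R (.pull i))
      ≤ ENNReal.ofReal (ε ^ 2 / (2 * (R : ℝ) ^ 2)) := by
  have hsq : (I.μ i - lowerMean τ I.μ k ε i) ^ 2 ≤ ε ^ 2 :=
    sq_le_sq.2 ((abs_sub_lowerMean_le_of_ne I.μ hik hε).trans (le_abs_self ε))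
  rw [klDiv_obs_pull I J hR, hμ]
  gcongr

lemma klDiv_obs_duel_lowerRow_le (hJ : J.M = lowerRow I.M k d) (hM : ∀ i j, 3 / 8 ≤ I.M i j)
    (hd0 : 0 ≤ d) (hd : d ≤ 0.26) (R : ℝ≥0) (i j : Fin K) :
    klDiv (obs I R (.duel i j)) (obs J R (.duel i j)) ≤ ENNReal.ofReal (10 * d ^ 2) := by
  have hshift : |J.M i j - I.M i j| ≤ d := by
    rw [hJ, lowerRow, add_sub_cancel_left, abs_le]
    split_ifs <;> constructor <;> linarith
  obtain ⟨hlo, hhi⟩ := abs_le.1 hshift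
  have hM' := I.M_le_one_sub hM i j
  have hJlo : 0.115 ≤ J.M i j := by linarith [hM i j]
  have hJhi : J.M i j ≤ 0.885 := by linarith
  have hvar : 1 / 10 ≤ J.M i j * (1 - J.M i j) := by
    nlinarith [mul_nonneg (sub_nonneg.2 hJlo) (sub_nonneg.2 hJhi)]
  refine (klDiv_obs_duel_le I J R (by linarith) (by linarith)).trans (ENNReal.ofReal_le_ofReal ?_)
  rw [div_le_iff₀ (by linarith)]
  calc
    (I.M i j - J.M i j) ^ 2 ≤ d ^ 2 := by
      rw [sub_sq_comm]
      exact sq_le_sq.2 (hshift.trans (le_abs_self d))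
    _ ≤ 10 * d ^ 2 * (J.M i j * (1 - J.M i j)) := by nlinarith [sq_nonneg d]

lemma klDiv_obs_duel_eq_zero_of_ne (hJ : J.M = lowerRow I.M k d) (R : ℝ≥0)
    {i j : Fin K} (hi : i ≠ k) (hj : j ≠ k) :
    klDiv (obs I R (.duel i j)) (obs J R (.duel i j)) = 0 := by
  have hMij : J.M i j = I.M i j := by simp [hJ, lowerRow, hi, hj]
  have hobs : obs J R (.duel i j) = obs I R (.duel i j) := by
    change obsLaw J R (.duel i j) = obsLaw I R (.duel i j)
    simp only [obsLaw, hMij]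
  rw [hobs, klDiv_self]

open Classical in
lemma klDiv_obs_lower_le (hμ : J.μ = lowerMean τ I.μ k ε) (hJ : J.M = lowerRow I.M k d)
    (hk : τ ≤ I.μ k) (hM : ∀ i j, 3 / 8 ≤ I.M i j) {R : ℝ≥0} (hR : 0 < R) (hε : 0 < ε)
    (hd0 : 0 ≤ d) (hd : d ≤ 0.26) (x : Decision K) :
    klDiv (obs I R x) (obs J R x)
      ≤ (if x.IsDuelOf k then ENNReal.ofReal (10 * d ^ 2) else 0)
        + (if x.IsPullOf k then ENNReal.ofReal ((I.pullGap k + ε) ^ 2 / (2 * (R : ℝ) ^ 2)) else 0)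
        + ENNReal.ofReal (ε ^ 2 / (2 * (R : ℝ) ^ 2)) := by
  cases x with
  | halt S => simp [klDiv_obs_halt]
  | pull i =>
    obtain rfl | hik := eq_or_ne i k
    · simp [Decision.IsDuelOf, Decision.IsPullOf, klDiv_obs_pull_self hμ hR hk]
    · simpa [Decision.IsDuelOf, Decision.IsPullOf, hik] using
        klDiv_obs_pull_le_of_ne hμ hR hε hik
  | duel i j =>
    by_cases hduel : i = k ∨ j = k
    · refine (klDiv_obs_duel_lowerRow_le hJ hM hd0 hd R i j).trans ?_
      simp only [Decision.IsDuelOf, hduel, if_true, add_assoc]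
      exact le_self_add
    · obtain ⟨hi, hj⟩ := not_or.1 hduel
      simp [klDiv_obs_duel_eq_zero_of_ne hJ R hi hj]

end Lower

end Alternative

section LowerBound

open InformationTheory Preorder Filter Topology

variable {K : ℕ} {τ : ℝ} {A : Algorithm K} {I J : Problem K τ} {R : ℝ≥0} {δ : ℝ}

lemma measurableSet_lastRound_eq_halt (S : Finset (Fin K)) (n : ℕ) :
    MeasurableSet {h : Finset.Iic n → Round K | (lastRound h).1 = .halt S} :=
  measurable_lastRound.fst (measurableSet_singleton (Decision.halt S))

namespace Algorithm

lemma Recovers.one_sub_le_measureReal_outputs (hI : A.Recovers I R δ) :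
    1 - δ ≤ (A.law I R).real {ω | Outputs I.posSet ω} :=
  (ENNReal.ofReal_le_iff_le_toReal (measure_ne_top _ _)).1 hI

lemma Recovers.measureReal_outputs_le (hJ : A.Recovers J R δ) {S : Finset (Fin K)}
    (hS : S ≠ J.posSet) : (A.law J R).real {ω | Outputs S ω} ≤ δ := by
  calc
    (A.law J R).real {ω | Outputs S ω} ≤ (A.law J R).real {ω | Outputs J.posSet ω}ᶜ :=
      measureReal_mono fun ω hω hω' => hS (hω.eq hω')
    _ = 1 - (A.law J R).real {ω | Outputs J.posSet ω} :=
      probReal_compl_eq_one_sub (measurableSet_outputs _)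
    _ ≤ δ := by linarith [hJ.one_sub_le_measureReal_outputs]

lemma measureReal_map_frestrictLe_stoppedLaw (A : Algorithm K) (I : Problem K τ) (R : ℝ≥0)
    (S : Finset (Fin K)) (n : ℕ) :
    ((A.stoppedLaw I R).map (frestrictLe n)).real {h | (lastRound h).1 = .halt S}
      = (A.law I R).real {ω | (freeze ω n).1 = .halt S} := by
  rw [stoppedLaw, Measure.map_map (by fun_prop) (by fun_prop),
    map_measureReal_apply (by fun_prop) (measurableSet_lastRound_eq_halt S n)]
  rfl

lemma ofReal_mul_log_le_sum_lintegral_klDiv (I : Problem K τ) (hJ : A.Recovers J R δ)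
    (hδ0 : 0 < δ) (hδ : δ ≤ 1 / 2) {S : Finset (Fin K)} (hS : S ≠ J.posSet) (n : ℕ) :
    ENNReal.ofReal ((2 * (A.law I R).real {ω | (freeze ω n).1 = .halt S} - 1)
        * Real.log ((1 - δ) / δ))
      ≤ ∑ t ∈ Finset.range (n + 1),
          ∫⁻ ω, klDiv (obs I R (ω t).1) (obs J R (ω t).1) ∂A.stoppedLaw I R := by
  have hsub : {ω | (freeze ω n).1 = .halt S} ⊆ {ω | Outputs S ω} :=
    fun ω hω => outputs_iff_exists_freeze_eq_halt.2 ⟨n, hω⟩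
  have := Measure.isProbabilityMeasure_map (μ := A.stoppedLaw I R)
    (measurable_frestrictLe (X := fun _ => Round K) n).aemeasurable
  have := Measure.isProbabilityMeasure_map (μ := A.stoppedLaw J R)
    (measurable_frestrictLe (X := fun _ => Round K) n).aemeasurable
  calc
    _ ≤ klDiv ((A.stoppedLaw I R).map (frestrictLe n))
          ((A.stoppedLaw J R).map (frestrictLe n)) := by
      rw [← measureReal_map_frestrictLe_stoppedLaw]
      refine ofReal_mul_log_div_le_klDiv _ _ (measurableSet_lastRound_eq_halt S n) hδ0 hδ ?_
      rw [measureReal_map_frestrictLe_stoppedLaw]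
      exact (measureReal_mono hsub).trans (hJ.measureReal_outputs_le hS)
    _ ≤ _ := (A.isInteractionLaw_stoppedLaw I R).klDiv_map_frestrictLe_le
      (A.isInteractionLaw_stoppedLaw J R) n

lemma lintegral_stoppedLaw_countUpTo_le {p : Decision K → Prop} {N : (ℕ → Round K) → ℝ≥0∞}
    {n : ℕ} (hN : ∀ ω, countUpTo p n (freeze ω) ≤ N ω) :
    ∫⁻ ω, countUpTo p n ω ∂A.stoppedLaw I R ≤ ∫⁻ ω, N ω ∂A.law I R := by
  rw [stoppedLaw, lintegral_map (by fun_prop) measurable_freeze]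
  exact lintegral_mono hN

end Algorithm

lemma ofReal_mul_log_le_of_pos {k : Fin K} (hK : 2 ≤ K) (hR : 0 < R) (hδ0 : 0 < δ) (hδ : δ ≤ 1 / 2)
    (hA : ∀ J : Problem K τ, (∀ i, J.μ i ≠ τ) → A.Recovers J R δ)
    (hM : ∀ i j, 3 / 8 ≤ I.M i j) (hk : k ∈ I.posSet) {ε : ℝ} (hε : 0 < ε)
    (hε' : ε ≤ 1 / 100) (n : ℕ) :
    ENNReal.ofReal ((2 * (A.law I R).real {ω | (freeze ω n).1 = .halt I.posSet} - 1)
        * Real.log ((1 - δ) / δ))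
      ≤ ENNReal.ofReal (10 * (I.duelGap k + ε) ^ 2)
            * ∫⁻ ω, countUpTo (Decision.IsDuelOf k) (n + 1) ω ∂A.stoppedLaw I R
          + ENNReal.ofReal ((I.pullGap k + ε) ^ 2 / (2 * (R : ℝ) ^ 2))
            * ∫⁻ ω, countUpTo (Decision.IsPullOf k) (n + 1) ω ∂A.stoppedLaw I R
          + (n + 1 : ℕ) * ENNReal.ofReal (ε ^ 2 / (2 * (R : ℝ) ^ 2)) := by
  have hkτ : τ ≤ I.μ k := (Finset.mem_filter.1 hk).2
  have hgap0 := I.duelGap_nonneg hkτ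
  have hgap1 := I.duelGap_le hK hM hkτ
  obtain ⟨J, hμ, hJ⟩ : ∃ J : Problem K τ, J.μ = lowerMean τ I.μ k ε
      ∧ J.M = lowerRow I.M k (I.duelGap k + ε) :=
    I.exists_lower hK hε (by linarith) (fun i hi => by linarith [I.score_sub_duelGap_le hkτ hi])
      (fun j => by linarith [hM k j])
  have hrec : A.Recovers J R δ := hA J fun i => hμ ▸ lowerMean_ne I.μ k hε i
  have hne : I.posSet ≠ J.posSet := fun h => notMem_posSet_of_lowerMean hμ hε (h ▸ hk)
  exact (Algorithm.ofReal_mul_log_le_sum_lintegral_klDiv I hrec hδ0 hδ hne n).trans <|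
    sum_lintegral_le_of_le_ite _
      (klDiv_obs_lower_le hμ hJ hkτ hM hR hε (by linarith) (by linarith)) (n + 1)

lemma ofReal_mul_log_le_countUpTo {k : Fin K} (hK : 2 ≤ K) (hR : 0 < R)
    (hδ0 : 0 < δ) (hδ : δ ≤ 1 / 2)
    (hA : ∀ J : Problem K τ, (∀ i, J.μ i ≠ τ) → A.Recovers J R δ)
    (hM : ∀ i j, 3 / 8 ≤ I.M i j) (hk : k ∈ I.posSet) (n : ℕ) :
    ENNReal.ofReal ((2 * (A.law I R).real {ω | (freeze ω n).1 = .halt I.posSet} - 1)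
        * Real.log ((1 - δ) / δ))
      ≤ ENNReal.ofReal (10 * I.duelGap k ^ 2)
            * ∫⁻ ω, countUpTo (Decision.IsDuelOf k) (n + 1) ω ∂A.stoppedLaw I R
          + ENNReal.ofReal (I.pullGap k ^ 2 / (2 * (R : ℝ) ^ 2))
            * ∫⁻ ω, countUpTo (Decision.IsPullOf k) (n + 1) ω ∂A.stoppedLaw I R := by
  have tendsto_ofReal {g : ℝ → ℝ} (hg : Continuous g) :
      Tendsto (fun ε => ENNReal.ofReal (g ε)) (𝓝[>] 0) (𝓝 (ENNReal.ofReal (g 0))) :=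
    (ENNReal.continuous_ofReal.comp hg).continuousWithinAt
  have hduel := ENNReal.Tendsto.mul_const
    (tendsto_ofReal (g := fun ε => 10 * (I.duelGap k + ε) ^ 2) (by fun_prop))
    (.inr (lintegral_countUpTo_ne_top (A.stoppedLaw I R) (Decision.IsDuelOf k) (n + 1)))
  have hpull := ENNReal.Tendsto.mul_const
    (tendsto_ofReal (g := fun ε => (I.pullGap k + ε) ^ 2 / (2 * (R : ℝ) ^ 2)) (by fun_prop))
    (.inr (lintegral_countUpTo_ne_top (A.stoppedLaw I R) (Decision.IsPullOf k) (n + 1)))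
  have hother := ENNReal.Tendsto.const_mul
    (tendsto_ofReal (g := fun ε => ε ^ 2 / (2 * (R : ℝ) ^ 2)) (by fun_prop))
    (.inr (ENNReal.natCast_ne_top (n + 1)))
  have hlim := (hduel.add hpull).add hother
  simp only [add_zero, ne_eq, OfNat.ofNat_ne_zero, not_false_eq_true, zero_pow, zero_div,
    ENNReal.ofReal_zero, mul_zero] at hlim
  refine ge_of_tendsto hlim ?_
  filter_upwards [Ioc_mem_nhdsGT (show (0 : ℝ) < 1 / 100 by norm_num)] with ε hε
  exact ofReal_mul_log_le_of_pos hK hR hδ0 hδ hA hM hk hε.1 hε.2 n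

lemma ofReal_mul_log_le_lintegral_numDuels_add {k : Fin K} (hK : 2 ≤ K) (hR : 0 < R)
    (hδ0 : 0 < δ) (hδ : δ ≤ 1 / 2)
    (hA : ∀ J : Problem K τ, (∀ i, J.μ i ≠ τ) → A.Recovers J R δ)
    (hM : ∀ i j, 3 / 8 ≤ I.M i j) (hk : k ∈ I.posSet) (hI : A.Recovers I R δ) :
    ENNReal.ofReal ((1 - 2 * δ) * Real.log ((1 - δ) / δ))
      ≤ ENNReal.ofReal (10 * I.duelGap k ^ 2) * ∫⁻ ω, numDuels k ω ∂A.law I R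
          + ENNReal.ofReal (I.pullGap k ^ 2 / (2 * (R : ℝ) ^ 2))
            * ∫⁻ ω, numPulls k ω ∂A.law I R := by
  have hlim := (ENNReal.continuous_ofReal.tendsto _).comp
    ((((tendsto_measureReal_freeze_eq_halt (A.law I R) I.posSet).const_mul 2).sub_const 1).mul_const
      (Real.log ((1 - δ) / δ)))
  have hlog : 0 ≤ Real.log ((1 - δ) / δ) :=
    Real.log_nonneg ((one_le_div hδ0).2 (by linarith))
  calc
    _ ≤ ENNReal.ofReal ((2 * (A.law I R).real {ω | Outputs I.posSet ω} - 1)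
          * Real.log ((1 - δ) / δ)) := by
      gcongr ENNReal.ofReal (?_ * _)
      linarith [hI.one_sub_le_measureReal_outputs]
    _ ≤ _ := by
      refine le_of_tendsto' hlim fun n =>
        (ofReal_mul_log_le_countUpTo hK hR hδ0 hδ hA hM hk n).trans ?_
      gcongr _ * ?_ + _ * ?_
      · exact Algorithm.lintegral_stoppedLaw_countUpTo_le (countUpTo_freeze_le_numDuels k (n + 1))
      · exact Algorithm.lintegral_stoppedLaw_countUpTo_le (countUpTo_freeze_le_numPulls k (n + 1))

lemma ofReal_min_mul_le_of_le_add {R g p x : ℝ} (hR : 0 < R) {D N : ℝ≥0∞}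
    (hx : ENNReal.ofReal x
      ≤ ENNReal.ofReal (10 * g ^ 2) * D + ENNReal.ofReal (p ^ 2 / (2 * R ^ 2)) * N) :
    ENNReal.ofReal (min (1 / 10) (R ^ 2 / 2) * x)
      ≤ ENNReal.ofReal (g ^ 2) * D + ENNReal.ofReal (p ^ 2) * N := by
  set c : ℝ := min (1 / 10) (R ^ 2 / 2)
  have hc : 0 ≤ c := by positivity
  have hc_duel : c * (10 * g ^ 2) ≤ g ^ 2 := by
    nlinarith [min_le_left (1 / 10) (R ^ 2 / 2), sq_nonneg g]
  have hc_pull : c * (p ^ 2 / (2 * R ^ 2)) ≤ p ^ 2 := by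
    rw [mul_div_assoc', div_le_iff₀ (by positivity)]
    nlinarith [min_le_right (1 / 10) (R ^ 2 / 2), sq_nonneg p, sq_nonneg R]
  calc
    ENNReal.ofReal (c * x) = ENNReal.ofReal c * ENNReal.ofReal x := ENNReal.ofReal_mul hc
    _ ≤ ENNReal.ofReal c
          * (ENNReal.ofReal (10 * g ^ 2) * D + ENNReal.ofReal (p ^ 2 / (2 * R ^ 2)) * N) := by
      gcongr
    _ = ENNReal.ofReal (c * (10 * g ^ 2)) * D
          + ENNReal.ofReal (c * (p ^ 2 / (2 * R ^ 2))) * N := by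
      rw [mul_add, ← mul_assoc, ← mul_assoc, ENNReal.ofReal_mul hc, ENNReal.ofReal_mul hc]
    _ ≤ _ := by gcongr

end LowerBound

end DuelBandit

end

open DuelBandit

theorem theorem2 {K : ℕ} (hK : 2 ≤ K) (τ : ℝ) (R : ℝ≥0) (hR : 0 < R)
    (δ : ℝ) (hδ0 : 0 < δ) (hδ : δ ≤ 0.15)
    (A : DuelBandit.Algorithm K)
    (hA : ∀ J : DuelBandit.Problem K τ, (∀ i, J.μ i ≠ τ) → A.Recovers J R δ)
    (I : DuelBandit.Problem K τ) (hI : A.Recovers I R δ)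
    (hM : ∀ i j, 3 / 8 ≤ I.M i j)
    (k : Fin K) (hk : k ∈ I.posSet) :
    ENNReal.ofReal (min (1 / 10) ((R : ℝ) ^ 2 / 2) * Real.log (1 / (2 * δ))) ≤
      ∫⁻ ω, (ENNReal.ofReal (I.duelGap k ^ 2) * DuelBandit.numDuels k ω
        + ENNReal.ofReal (I.pullGap k ^ 2) * DuelBandit.numPulls k ω) ∂(A.law I R) := by
  calc
    _ ≤ ENNReal.ofReal
          (min (1 / 10) ((R : ℝ) ^ 2 / 2) * ((1 - 2 * δ) * Real.log ((1 - δ) / δ))) := by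
      gcongr
      exact log_one_div_two_mul_le hδ0 hδ
    _ ≤ ENNReal.ofReal (I.duelGap k ^ 2) * ∫⁻ ω, numDuels k ω ∂A.law I R
          + ENNReal.ofReal (I.pullGap k ^ 2) * ∫⁻ ω, numPulls k ω ∂A.law I R :=
      ofReal_min_mul_le_of_le_add hR
        (ofReal_mul_log_le_lintegral_numDuels_add hK hR hδ0 (by linarith) hA hM hk hI)
    _ ≤ _ := (add_le_add (lintegral_const_mul_le _ _) (lintegral_const_mul_le _ _)).trans
      (le_lintegral_add _ _)
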